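/- **Montel's Theorem for distributions.** For a real number $h$, let $\tau_h$ act on test functions $\varphi\in\mathcal D(\mathbb R)$ by $(\tau_h\varphi)(t)=\varphi(t+h)$ and on complex-valued Schwartz distributions $f$ on $\mathbb R$ by $(\tau_h f)\{\varphi\}=f\{\tau_{-h}\varphi\}$. Put $\Delta_h f=\tau_h f-f$ and let $\Delta_h^m$ be the $m$-th iterate of $\Delta_h$. Let $m\ge 1$ be an integer and let $f$ be a complex-valued distribution on $\mathbb R$ such that $$\Delta_{h_1}^m f=\Delta_{h_2}^m f=0$$ for some nonzero real numbers $h_1,h_2$ with $h_1/h_2\notin\mathbb Q$. Then $f$ is an ordinary polynomial of degree at most $m-1$; that is, there is a polynomial $p\in\mathbb C[t]$ of degree at most $m-1$ (possibly $p=0$) such that $f\{\varphi\}=\int_{\mathbb R}\varphi(t)\,p(t)\,dt$ for every test function $\varphi$. -/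

import Mathlib

open scoped Distributions

noncomputable section

namespace MontelDistribution

open TopologicalSpace

/-- The space `𝓓(ℝ)` of test functions: compactly supported `C^∞` functions `ℝ → ℝ`,
with the canonical LF topology. -/
abbrev TestFun : Type := 𝓓((⊤ : Opens ℝ), ℝ)

/-- The space of complex valued (Schwartz) distributions on `ℝ`. -/
abbrev Distr : Type := 𝓓'((⊤ : Opens ℝ), ℂ)

/-- The translate `t ↦ φ (t + h)` of a test function `φ`. -/
def translateTest (h : ℝ) (φ : TestFun) : TestFun where
  toFun t := φ (t + h)
  contDiff' := φ.contDiff.comp (contDiff_id.add contDiff_const)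
  hasCompactSupport' := φ.hasCompactSupport.comp_homeomorph (Homeomorph.addRight h)
  tsupport_subset' := fun _ _ => trivial

/-- Translation between the spaces of smooth functions supported in `K` and in `K - h`. -/
def translateSupportedIn (h : ℝ) (K : Compacts ℝ) :
    𝓓_{K}(ℝ, ℝ) →L[ℝ] 𝓓_{K.map (fun t => t - h) (by fun_prop)}(ℝ, ℝ) :=
  ContDiffMapSupportedIn.mkCLM ℝ (fun φ t => φ (t + h))
    (fun _ _ _ => rfl) (fun _ _ _ => rfl)
    (fun φ => φ.contDiff.comp (contDiff_id.add contDiff_const))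
    (fun φ t ht => φ.zero_on_compl fun hK => ht ⟨t + h, hK, by simp⟩)
    (fun i _ => ⟨{i}, 1, zero_le_one, fun φ t _ => by
      rw [iteratedFDeriv_comp_add_right]
      simpa using ContDiffMapSupportedIn.norm_iteratedFDeriv_apply_le_seminorm_top ℝ⟩)

/-- Translation `τ_h` on test functions, `(τ_h φ)(t) = φ (t + h)`, as a continuous linear map. -/
def translateTestCLM (h : ℝ) : TestFun →L[ℝ] TestFun :=
  TestFunction.limitCLM ℝ (translateTest h)
    (fun K _ => (TestFunction.ofSupportedInCLM ℝ (fun _ _ => trivial)) ∘L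
      translateSupportedIn h K)
    (fun _ _ _ => rfl)

theorem translateTestCLM_apply (h : ℝ) (φ : TestFun) (t : ℝ) :
    translateTestCLM h φ t = φ (t + h) := rfl

/-- Translation `τ_h` on distributions, `(τ_h f){φ} = f{τ_{-h} φ}`. -/
def translate (h : ℝ) : Distr →L[ℝ] Distr :=
  (translateTestCLM (-h)).precompCompactConvergenceCLM ℂ

theorem translate_apply (h : ℝ) (f : Distr) (φ : TestFun) :
    translate h f φ = f (translateTestCLM (-h) φ) := rfl

/-- The first difference operator `Δ_h = τ_h - 1` on distributions;
its iterates are the powers `Δ_h ^ m`. -/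
def difference (h : ℝ) : Distr →L[ℝ] Distr :=
  translate h - ContinuousLinearMap.id ℝ Distr

theorem difference_apply (h : ℝ) (f : Distr) (φ : TestFun) :
    difference h f φ = f (translateTestCLM (-h) φ) - f φ := rfl

/-- The distribution `f` is (given by integration against) the ordinary polynomial `p`. -/
def IsPolynomial (f : Distr) (p : Polynomial ℂ) : Prop :=
  ∀ φ : TestFun, f φ = ∫ t : ℝ, (φ t : ℂ) * p.eval (t : ℂ)

end MontelDistribution

end

/-! For a fixed test function `φ`, the orbit `g x = f (translateTestCLM (-x) φ)` is smooth with
`m`-th derivative `(-1)^m f(τ_{-x} φ^(m))`, and differences of `f` become differences of `g`. So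
Montel's theorem for smooth functions gives `g^(m) = 0`, and `x = 0` yields `f(φ^(m)) = 0`
(`apply_derivTest_iterate_eq_zero`).

In the smooth case, suppose `Δ_a^(m+1)` and `Δ_b^(m+1)` kill `g`. Then `Δ_a^m g` is `a`-periodic,
hence bounded; being bounded and killed by `Δ_b^(m+1)`, it is also `b`-periodic, hence constant.
Thus `Δ_a^m g' = 0`, likewise for `b`, and induction applies to `g'`.

A test function whose moments of order below `m` vanish is an `m`-th derivative, so `f` vanishes on
the common kernel of these moments and is a combination of them, i.e. a polynomial. -/

open scoped Distributions

noncomputable section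

namespace MontelDistribution

open TopologicalSpace MeasureTheory Set Filter Topology fwdDiff

/-! ### Montel's theorem for smooth functions -/

section FwdDiff

/-- A bounded function annihilated by a power of `Δ_h` is annihilated by `Δ_h`. -/
theorem fwdDiff_eq_zero_of_bounded {h : ℝ} (n : ℕ) {v : ℝ → ℂ} {C : ℝ} (hC : ∀ x, ‖v x‖ ≤ C)
    (hv : (fwdDiff h)^[n + 1] v = 0) : Δ_[h] v = 0 := by
  induction n generalizing v C with
  | zero => simpa using hv
  | succ n ih =>
    have hbd : ∀ x, ‖Δ_[h] v x‖ ≤ C + C := fun x =>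
      (norm_sub_le _ _).trans (add_le_add (hC _) (hC _))
    have h2 : Δ_[h] (Δ_[h] v) = 0 := ih hbd (by rwa [← Function.iterate_succ_apply])
    have hper : ∀ x, Δ_[h] v (x + h) = Δ_[h] v x := fun x => sub_eq_zero.1 (congrFun h2 x)
    have hstep : ∀ x (k : ℕ), Δ_[h] v (x + k * h) = Δ_[h] v x := by
      intro x k
      induction k with
      | zero => simp
      | succ k ihk => rw [← ihk, ← hper (x + k * h)]; congr 1; push_cast; ring
    -- Linear growth along `x + k h` is incompatible with boundedness unless the slope is zero.
    have hlin : ∀ x (k : ℕ), v (x + k * h) = v x + k * Δ_[h] v x := by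
      intro x k
      induction k with
      | zero => simp
      | succ k ihk =>
        have := hstep x k
        rw [fwdDiff, ihk] at this
        rw [show x + ((k + 1 : ℕ) : ℝ) * h = x + k * h + h by push_cast; ring]
        push_cast
        linear_combination this
    funext x
    by_contra hne
    have hpos : 0 < ‖Δ_[h] v x‖ := norm_pos_iff.2 hne
    obtain ⟨k, hk⟩ := exists_nat_gt ((C + C) / ‖Δ_[h] v x‖)
    rw [div_lt_iff₀ hpos] at hk
    have : (k : ℂ) * Δ_[h] v x = v (x + k * h) - v x := by rw [hlin]; ring
    have h3 : (k : ℝ) * ‖Δ_[h] v x‖ = ‖v (x + k * h) - v x‖ := by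
      rw [← this, norm_mul, Complex.norm_natCast]
    have h4 := (norm_sub_le (v (x + k * h)) (v x)).trans (add_le_add (hC _) (hC _))
    linarith

/-- A continuous function with two incommensurable periods is constant. -/
theorem eq_of_periodic_of_irrational {a b : ℝ} (hab : Irrational (a / b)) {u : ℝ → ℂ}
    (hu : Continuous u) (ha : Function.Periodic u a) (hb : Function.Periodic u b) (x : ℝ) :
    u x = u 0 := by
  have hcl : ∀ y ∈ AddSubgroup.closure {a, b}, Function.Periodic u y := by
    intro y hy
    induction hy using AddSubgroup.closure_induction with
    | mem y hy => rcases hy with rfl | rfl <;> assumption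
    | zero => intro x; simp
    | add y z _ _ hy hz => exact hy.add_period hz
    | neg y _ hy => exact hy.neg
  have hd := (dense_addSubgroupClosure_pair_iff (a := a) (b := b)).2 hab
  have := Continuous.ext_on hd hu (continuous_const (y := u 0)) fun y hy => by
    simpa using hcl y hy 0
  exact congrFun this x

theorem continuous_fwdDiff_iter {h : ℝ} (n : ℕ) {g : ℝ → ℂ} (hg : Continuous g) :
    Continuous ((fwdDiff h)^[n] g) := by
  induction n generalizing g with
  | zero => exact hg
  | succ n ih => exact ih ((hg.comp (continuous_add_const h)).sub hg)

theorem hasDerivAt_fwdDiff_iter {h : ℝ} (n : ℕ) {g g' : ℝ → ℂ}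
    (hg : ∀ x, HasDerivAt g (g' x) x) (x : ℝ) :
    HasDerivAt ((fwdDiff h)^[n] g) ((fwdDiff h)^[n] g' x) x := by
  induction n generalizing g g' with
  | zero => exact hg x
  | succ n ih => exact ih fun y => ((hg (y + h)).comp_add_const y h).sub (hg y)

theorem fwdDiff_comm (a b : ℝ) : Function.Commute (fwdDiff a : (ℝ → ℂ) → ℝ → ℂ) (fwdDiff b) := by
  intro g
  funext x
  simp only [fwdDiff, add_right_comm x a b]
  ring

theorem fwdDiff_iter_zero (a : ℝ) (n : ℕ) : (fwdDiff a)^[n] (0 : ℝ → ℂ) = 0 := by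
  rw [← fwdDiff_aux.coe_fwdDiffₗ_pow, map_zero]

/-- **Montel's theorem** for smooth functions, given with the sequence of their derivatives:
if `Δ_a ^ m` and `Δ_b ^ m` annihilate `g 0`, then the `m`-th derivative `g m` vanishes. -/
theorem deriv_eq_zero_of_fwdDiff_iter_eq_zero {a b : ℝ} (ha : a ≠ 0) (hab : Irrational (a / b))
    (m : ℕ) (g : ℕ → ℝ → ℂ) (hg : ∀ k x, HasDerivAt (g k) (g (k + 1) x) x)
    (hga : (fwdDiff a)^[m] (g 0) = 0) (hgb : (fwdDiff b)^[m] (g 0) = 0) : g m = 0 := by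
  induction m generalizing g with
  | zero => exact hga
  | succ m ih =>
    have hc : Continuous (g 0) := continuous_iff_continuousAt.2 fun x => (hg 0 x).continuousAt
    -- Stated for a generic pair because it is used twice, with `a` and `b` exchanged.
    have main : ∀ {c d : ℝ}, c ≠ 0 → Irrational (c / d) → (fwdDiff c)^[m + 1] (g 0) = 0 →
        (fwdDiff d)^[m + 1] (g 0) = 0 → (fwdDiff c)^[m] (g 1) = 0 := by
      intro c d hc0 hcd hgc hgd
      have huc := continuous_fwdDiff_iter (h := c) m hc
      have hper : Function.Periodic ((fwdDiff c)^[m] (g 0)) c := fun x => by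
        rw [Function.iterate_succ_apply'] at hgc
        exact sub_eq_zero.1 (congrFun hgc x)
      obtain ⟨C, hC⟩ := isBounded_iff_forall_norm_le.1 (hper.isBounded_of_continuous hc0 huc)
      have hd : (fwdDiff d)^[m + 1] ((fwdDiff c)^[m] (g 0)) = 0 := by
        rw [((fwdDiff_comm d c).iterate_iterate (m + 1) m) (g 0), hgd, fwdDiff_iter_zero]
      have hd1 := fwdDiff_eq_zero_of_bounded m (fun x => hC _ (mem_range_self x)) hd
      have hconst := eq_of_periodic_of_irrational hcd huc hper
        fun x => sub_eq_zero.1 (congrFun hd1 x)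
      funext x
      have h1 := hasDerivAt_fwdDiff_iter (h := c) m (hg 0) x
      rw [show (fwdDiff c)^[m] (g 0) = fun _ => (fwdDiff c)^[m] (g 0) 0 from funext hconst] at h1
      exact h1.unique (hasDerivAt_const _ _)
    have hb : b ≠ 0 := by rintro rfl; simp at hab
    exact ih (fun k => g (k + 1)) (fun k => hg (k + 1)) (main ha hab hga hgb)
      (main hb (by simpa using hab.inv) hgb hga)

end FwdDiff

/-! ### Differentiating a distribution along translations -/

section Deriv

/-- The derivative of a test function. -/
def derivTest (φ : TestFun) : TestFun where
  toFun := deriv φ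
  contDiff' := contDiff_infty_iff_deriv.1 φ.contDiff |>.2
  hasCompactSupport' := φ.hasCompactSupport.deriv
  tsupport_subset' := fun _ _ => trivial

theorem hasDerivAt_test (φ : TestFun) (t : ℝ) : HasDerivAt φ (derivTest φ t) t :=
  ((φ.contDiff.differentiable (by simp)) t).hasDerivAt

theorem derivTest_translateTestCLM (h : ℝ) (φ : TestFun) :
    derivTest (translateTestCLM h φ) = translateTestCLM h (derivTest φ) := by
  ext t
  exact (hasDerivAt_test (translateTestCLM h φ) t).unique
    ((hasDerivAt_test φ (t + h)).comp_add_const t h)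

theorem hasDerivAt_iteratedDeriv_test (φ : TestFun) (i : ℕ) (t : ℝ) :
    HasDerivAt (iteratedDeriv i φ) (iteratedDeriv (i + 1) φ t) t := by
  rw [iteratedDeriv_succ]
  exact ((φ.contDiff.differentiable_iteratedDeriv i (by exact_mod_cast ENat.natCast_lt_top i)) t).hasDerivAt

theorem exists_bound_iteratedDeriv (φ : TestFun) (i : ℕ) :
    ∃ M, ∀ t, ‖iteratedDeriv i φ t‖ ≤ M := by
  have hs : HasCompactSupport (iteratedDeriv i φ) := by
    induction i with
    | zero => simpa using φ.hasCompactSupport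
    | succ i ih => rw [iteratedDeriv_succ]; exact ih.deriv
  exact (continuous_iff_continuousAt.2 fun t =>
    (hasDerivAt_iteratedDeriv_test φ i t).continuousAt).bounded_above_of_compact_support hs

/-- The first order Taylor remainder of a test function. -/
def taylorRemainder (h : ℝ) (φ : TestFun) : TestFun :=
  translateTestCLM h φ - φ - h • derivTest φ

theorem taylorRemainder_apply (h : ℝ) (φ : TestFun) (t : ℝ) :
    taylorRemainder h φ t = φ (t + h) - φ t - h * deriv φ t := rfl

theorem iteratedDeriv_taylorRemainder (h : ℝ) (φ : TestFun) (i : ℕ) (t : ℝ) :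
    iteratedDeriv i (taylorRemainder h φ) t =
      iteratedDeriv i φ (t + h) - iteratedDeriv i φ t - h * iteratedDeriv (i + 1) φ t := by
  induction i generalizing t with
  | zero => simp [taylorRemainder_apply]
  | succ i ih =>
    rw [iteratedDeriv_succ, funext ih]
    exact ((((hasDerivAt_iteratedDeriv_test φ i (t + h)).comp_add_const t h).sub
      (hasDerivAt_iteratedDeriv_test φ i t)).sub
      ((hasDerivAt_iteratedDeriv_test φ (i + 1) t).const_mul h)).deriv

/-- The mean value inequality is applied twice, each time gaining a factor `‖h‖`. -/
theorem norm_iteratedDeriv_taylorRemainder_le (φ : TestFun) (i : ℕ) {M : ℝ}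
    (hM : ∀ t, ‖iteratedDeriv (i + 2) φ t‖ ≤ M) (h t : ℝ) :
    ‖iteratedDeriv i (taylorRemainder h φ) t‖ ≤ M * ‖h‖ * ‖h‖ := by
  have hM0 : 0 ≤ M := (norm_nonneg _).trans (hM 0)
  have hlip : ∀ u, ‖iteratedDeriv (i + 1) φ (t + u) - iteratedDeriv (i + 1) φ t‖ ≤ M * ‖u‖ := by
    intro u
    simpa using convex_univ.norm_image_sub_le_of_norm_hasDerivWithin_le
      (fun s _ => (hasDerivAt_iteratedDeriv_test φ (i + 1) s).hasDerivWithinAt)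
      (fun s _ => hM s) (mem_univ t) (mem_univ (t + u))
  have := (convex_closedBall (0 : ℝ) ‖h‖).norm_image_sub_le_of_norm_hasDerivWithin_le
    (f := fun u => iteratedDeriv i φ (t + u) - u * iteratedDeriv (i + 1) φ t)
    (f' := fun u => iteratedDeriv (i + 1) φ (t + u) - 1 * iteratedDeriv (i + 1) φ t)
    (C := M * ‖h‖) (x := 0) (y := h)
    (fun u _ => (((hasDerivAt_iteratedDeriv_test φ i (t + u)).comp_const_add t u).sub
        ((hasDerivAt_id u).mul_const (iteratedDeriv (i + 1) φ t))).hasDerivWithinAt)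
    (fun u hu => by
      rw [one_mul]
      exact (hlip u).trans (mul_le_mul_of_nonneg_left (by simpa using hu) hM0))
    (by simp) (by simp)
  rw [iteratedDeriv_taylorRemainder]
  rw [sub_zero, add_zero, zero_mul, sub_zero, sub_right_comm] at this
  exact this

/-- The linear functional underlying a distribution. -/
def toLinearMap (f : Distr) : TestFun →ₗ[ℝ] ℂ where
  toFun := f
  map_add' := map_add f
  map_smul' := map_smul f

/-- On functions supported in a fixed compact set, continuity bounds `f` by finitely many derivative
seminorms, each of which is `O(h ^ 2)` on the remainder. -/
theorem exists_norm_apply_taylorRemainder_le (f : Distr) (φ : TestFun) :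
    ∃ C, ∀ h : ℝ, ‖h‖ ≤ 1 → ‖f (taylorRemainder h φ)‖ ≤ C * ‖h ^ 2‖ := by
  -- The 1-thickening contains the supports of all remainders with `‖h‖ ≤ 1`.
  let K : Compacts ℝ :=
    ⟨Metric.cthickening 1 (tsupport φ), φ.hasCompactSupport.isCompact.cthickening⟩
  let T : 𝓓_{K}(ℝ, ℝ) →ₗ[ℝ] ℂ := toLinearMap f ∘ₗ
    (TestFunction.ofSupportedInCLM ℝ (Ω := ⊤) (subset_univ _) : 𝓓_{K}(ℝ, ℝ) →L[ℝ] TestFun)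
  have hT : Continuous T :=
    (map_continuous f).comp (TestFunction.continuous_ofSupportedIn (subset_univ _))
  obtain ⟨s, C, -, hC⟩ := Seminorm.bound_of_continuous
    (ContDiffMapSupportedIn.withSeminorms ℝ ℝ ℝ ⊤ K) ((normSeminorm ℝ ℂ).comp T)
    (continuous_norm.comp hT)
  choose M hM using fun i => exists_bound_iteratedDeriv φ (i + 2)
  have hM0 : ∀ i, 0 ≤ M i := fun i => (norm_nonneg _).trans (hM i 0)
  refine ⟨C * ∑ i ∈ s, M i, fun h hh => ?_⟩
  have hzero : ∀ t ∉ (K : Set ℝ), taylorRemainder h φ t = 0 := by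
    intro t ht
    have hmem : ∀ u : ℝ, ‖u‖ ≤ 1 → t + u ∉ tsupport φ := fun u hu hmem =>
      ht (Metric.mem_cthickening_of_dist_le t (t + u) 1 _ hmem (by simpa using hu))
    have h0 : t ∉ tsupport φ := by simpa using hmem 0 (by simp)
    have h1 : deriv φ t = 0 :=
      image_eq_zero_of_notMem_tsupport fun h2 => h0 (tsupport_deriv_subset h2)
    rw [taylorRemainder_apply, image_eq_zero_of_notMem_tsupport (hmem h hh),
      image_eq_zero_of_notMem_tsupport h0, h1]
    simp
  let R : 𝓓_{K}(ℝ, ℝ) := ⟨taylorRemainder h φ, (taylorRemainder h φ).contDiff, hzero⟩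
  have hsum : 0 ≤ ∑ i ∈ s, M i := Finset.sum_nonneg fun i _ => hM0 i
  have hsup : (s.sup (ContDiffMapSupportedIn.seminorm ℝ ℝ ℝ ⊤ K)) R ≤
      (∑ i ∈ s, M i) * ‖h ^ 2‖ := by
    refine Seminorm.finset_sup_apply_le (by positivity) fun i hi => ?_
    rw [ContDiffMapSupportedIn.seminorm_top_le_iff ℝ (by positivity)]
    intro t _
    rw [norm_iteratedFDeriv_eq_norm_iteratedDeriv]
    refine (norm_iteratedDeriv_taylorRemainder_le φ i (hM i) h t).trans ?_
    rw [norm_pow, pow_two, mul_assoc]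
    exact mul_le_mul_of_nonneg_right (Finset.single_le_sum (fun j _ => hM0 j) hi) (by positivity)
  calc ‖f (taylorRemainder h φ)‖ ≤ C * (s.sup (ContDiffMapSupportedIn.seminorm ℝ ℝ ℝ ⊤ K)) R :=
        hC R
    _ ≤ C * ((∑ i ∈ s, M i) * ‖h ^ 2‖) := mul_le_mul_of_nonneg_left hsup C.2
    _ = C * (∑ i ∈ s, M i) * ‖h ^ 2‖ := by ring

theorem translateTestCLM_zero (φ : TestFun) : translateTestCLM 0 φ = φ := by
  ext t; simp [translateTestCLM_apply]

theorem translateTestCLM_translateTestCLM (a b : ℝ) (φ : TestFun) :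
    translateTestCLM a (translateTestCLM b φ) = translateTestCLM (a + b) φ := by
  ext t; simp [translateTestCLM_apply, add_assoc]

theorem hasDerivAt_apply_translateTestCLM_zero (f : Distr) (φ : TestFun) :
    HasDerivAt (fun h => f (translateTestCLM h φ)) (f (derivTest φ)) 0 := by
  obtain ⟨C, hC⟩ := exists_norm_apply_taylorRemainder_le f φ
  rw [hasDerivAt_iff_isLittleO_nhds_zero]
  have hO : (fun h : ℝ => f (taylorRemainder h φ)) =O[𝓝 0] fun h => h ^ 2 :=
    Asymptotics.IsBigO.of_bound C <| by
      filter_upwards [Metric.closedBall_mem_nhds (0 : ℝ) one_pos] with h hh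
      exact hC h (by simpa using hh)
  have ho : (fun h : ℝ => h ^ 2) =o[𝓝 0] fun h => h := by
    simpa using Asymptotics.isLittleO_pow_pow (𝕜 := ℝ) one_lt_two
  refine (hO.trans_isLittleO ho).congr_left fun h => ?_
  rw [taylorRemainder, map_sub, map_sub, map_smul, zero_add, translateTestCLM_zero]

theorem hasDerivAt_apply_translateTestCLM (f : Distr) (φ : TestFun) (x : ℝ) :
    HasDerivAt (fun h => f (translateTestCLM h φ)) (f (translateTestCLM x (derivTest φ))) x := by
  have h := hasDerivAt_apply_translateTestCLM_zero f (translateTestCLM x φ)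
  rw [derivTest_translateTestCLM, ← sub_self x] at h
  have := h.comp_sub_const x x
  simpa only [translateTestCLM_translateTestCLM, sub_add_cancel] using this

end Deriv

/-! ### From differences of `f` to differences of its orbits -/

section Differences

theorem difference_pow_apply (h : ℝ) (m : ℕ) (f : Distr) (φ : TestFun) (x : ℝ) :
    (difference h ^ m) f (translateTestCLM (-x) φ) =
      (fwdDiff h)^[m] (fun x => f (translateTestCLM (-x) φ)) x := by
  induction m generalizing f with
  | zero => rfl
  | succ m ih =>
    rw [pow_succ, mul_apply_eq_comp, ih, Function.iterate_succ_apply]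
    refine congrArg (fun g => (fwdDiff h)^[m] g x) (funext fun y => ?_)
    rw [difference_apply, translateTestCLM_translateTestCLM, fwdDiff, neg_add_rev]

/-- The `m`-th distributional derivative of a distribution annihilated by `Δ_a ^ m` and `Δ_b ^ m`
vanishes. -/
theorem apply_derivTest_iterate_eq_zero {a b : ℝ} (ha : a ≠ 0) (hab : Irrational (a / b))
    {m : ℕ} {f : Distr} (hfa : (difference a ^ m) f = 0) (hfb : (difference b ^ m) f = 0)
    (φ : TestFun) : f (derivTest^[m] φ) = 0 := by
  have hg : ∀ (k : ℕ) (x : ℝ), HasDerivAt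
      (fun x => (-1) ^ k * f (translateTestCLM (-x) (derivTest^[k] φ)))
      ((-1) ^ (k + 1) * f (translateTestCLM (-x) (derivTest^[k + 1] φ))) x := by
    intro k x
    have h1 := (hasDerivAt_apply_translateTestCLM f (derivTest^[k] φ) (-x)).scomp x
      (hasDerivAt_neg x)
    rw [← Function.iterate_succ_apply' derivTest k φ] at h1
    refine (h1.const_mul ((-1 : ℂ) ^ k)).congr_deriv ?_
    rw [neg_one_smul, pow_succ]
    ring
  have hz : ∀ c : ℝ, (difference c ^ m) f = 0 →
      (fwdDiff c)^[m] (fun x => (-1) ^ 0 * f (translateTestCLM (-x) (derivTest^[0] φ))) = 0 := by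
    intro c hc
    funext x
    rw [funext fun x : ℝ => show (-1 : ℂ) ^ 0 * f (translateTestCLM (-x) (derivTest^[0] φ)) =
      f (translateTestCLM (-x) φ) from one_mul _, ← difference_pow_apply, hc]
    rfl
  have := congrFun (deriv_eq_zero_of_fwdDiff_iter_eq_zero ha hab m _ hg (hz a hfa) (hz b hfb)) 0
  simpa [translateTestCLM_zero] using this

end Differences

/-! ### Moments and primitives of test functions -/

section Moments

theorem integrable_mul_test {g : ℝ → ℝ} (hg : Continuous g) (φ : TestFun) :
    Integrable fun t => g t * φ t :=
  (hg.mul φ.continuous).integrable_of_hasCompactSupport φ.hasCompactSupport.mul_left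

/-- The `k`-th moment of a test function. -/
def moment (k : ℕ) : TestFun →ₗ[ℝ] ℝ where
  toFun φ := ∫ t, t ^ k * φ t
  map_add' φ ψ := by
    rw [← integral_add (integrable_mul_test (by fun_prop) φ) (integrable_mul_test (by fun_prop) ψ)]
    exact integral_congr_ae (.of_forall fun t => mul_add _ _ _)
  map_smul' c φ := by
    rw [RingHom.id_apply, smul_eq_mul, ← integral_const_mul]
    exact integral_congr_ae (.of_forall fun t => mul_left_comm _ _ _)

theorem moment_apply (k : ℕ) (φ : TestFun) : moment k φ = ∫ t, t ^ k * φ t := rfl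

theorem moment_succ_derivTest (k : ℕ) (φ : TestFun) :
    moment (k + 1) (derivTest φ) = -((k + 1) * moment k φ) := by
  have h1 := integrable_mul_test (g := fun t => (k + 1) * t ^ k) (by fun_prop) φ
  have h2 := integrable_mul_test (g := fun t => t ^ (k + 1)) (by fun_prop) (derivTest φ)
  have := integral_eq_zero_of_hasDerivAt_of_integrable
    (f := fun t => t ^ (k + 1) * φ t)
    (f' := fun t => (k + 1) * t ^ k * φ t + t ^ (k + 1) * derivTest φ t)
    (fun t => by simpa [Pi.mul_def] using (hasDerivAt_pow (k + 1) t).mul (hasDerivAt_test φ t))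
    (h1.add h2) (integrable_mul_test (by fun_prop) φ)
  rw [integral_add h1 h2] at this
  simp only [mul_assoc, integral_const_mul] at this
  simp only [moment_apply]
  linarith

/-- The primitive from the left of the support equals the total integral, zero, to its right, so it
is compactly supported. -/
theorem exists_derivTest_eq {φ : TestFun} (hφ : moment 0 φ = 0) : ∃ ψ, derivTest ψ = φ := by
  have hint : Integrable φ := φ.continuous.integrable_of_hasCompactSupport φ.hasCompactSupport
  have h0 : ∫ t, φ t = 0 := by simpa [moment_apply] using hφ
  obtain ⟨r, hr0, hr⟩ := φ.hasCompactSupport.isCompact.isBounded.subset_closedBall_lt 0 0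
  have hz : ∀ t, r + 1 ≤ |t| → φ t = 0 := fun t ht =>
    image_eq_zero_of_notMem_tsupport fun hmem => by
      have : |t| ≤ r := by simpa using hr hmem
      linarith
  let ψ : ℝ → ℝ := fun x => ∫ t in (-(r + 1))..x, φ t
  have hderiv : ∀ x, HasDerivAt ψ (φ x) x := fun x =>
    intervalIntegral.integral_hasDerivAt_right (φ.continuous.intervalIntegrable _ _)
      (φ.continuous.stronglyMeasurableAtFilter _ _) φ.continuous.continuousAt
  have hd : deriv ψ = φ := funext fun x => (hderiv x).deriv
  have hsmooth : ContDiff ℝ (⊤ : ℕ∞) ψ :=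
    contDiff_infty_iff_deriv.2 ⟨fun x => (hderiv x).differentiableAt, hd ▸ φ.contDiff⟩
  have hleft : ∀ x, x < -(r + 1) → ψ x = 0 := fun x hx => by
    rw [← intervalIntegral.integral_zero (a := -(r + 1)) (b := x)]
    refine intervalIntegral.integral_congr fun t ht => hz t ?_
    rw [uIcc_of_ge hx.le] at ht
    exact (le_neg.1 ht.2).trans (neg_le_abs t)
  have hright : ∀ x, r + 1 < x → ψ x = 0 := fun x hx => by
    refine (intervalIntegral.integral_eq_integral_of_support_subset fun t ht => ?_).trans h0
    have := abs_lt.1 (not_le.1 (mt (hz t) ht))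
    exact ⟨this.1, this.2.le.trans hx.le⟩
  have hsupp : HasCompactSupport ψ :=
    HasCompactSupport.intro (isCompact_Icc (a := -(r + 1)) (b := r + 1)) fun x hx => by
      rcases lt_or_ge x (-(r + 1)) with h | h
      · exact hleft x h
      · exact hright x (lt_of_not_ge fun h' => hx ⟨h, h'⟩)
  exact ⟨⟨ψ, hsmooth, hsupp, fun _ _ => trivial⟩, TestFunction.ext fun x => congrFun hd x⟩

theorem exists_derivTest_iterate_eq {m : ℕ} {φ : TestFun} (hφ : ∀ k < m, moment k φ = 0) :
    ∃ ψ, derivTest^[m] ψ = φ := by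
  induction m generalizing φ with
  | zero => exact ⟨φ, rfl⟩
  | succ m ih =>
    obtain ⟨χ, rfl⟩ := exists_derivTest_eq (hφ 0 m.succ_pos)
    obtain ⟨ψ, rfl⟩ := ih (φ := χ) fun k hk => by
      -- Integration by parts lowers the order: moment `k` of the primitive `χ` is a nonzero
      -- multiple of moment `k + 1` of its derivative.
      have := hφ (k + 1) (by lia)
      rw [moment_succ_derivTest, neg_eq_zero, mul_eq_zero] at this
      exact this.resolve_left (by positivity)
    exact ⟨ψ, Function.iterate_succ_apply' _ _ _⟩

/-- A real linear functional whose `m`-th derivative vanishes is a combination of moments. -/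
theorem exists_eq_sum_moment {m : ℕ} {L : TestFun →ₗ[ℝ] ℝ}
    (hL : ∀ φ, L (derivTest^[m] φ) = 0) :
    ∃ c : Fin m → ℝ, ∀ φ, L φ = ∑ k, c k * moment k φ := by
  have hmem : L ∈ Submodule.span ℝ (range fun k : Fin m => moment k) :=
    mem_span_of_iInf_ker_le_ker fun φ hφ => by
      obtain ⟨ψ, rfl⟩ := exists_derivTest_iterate_eq (m := m) (φ := φ) fun k hk => by
        simpa using (Submodule.mem_iInf _).1 hφ ⟨k, hk⟩
      exact hL ψ
  obtain ⟨c, hc⟩ := (Submodule.mem_span_range_iff_exists_fun ℝ).1 hmem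
  exact ⟨c, fun φ => by simp [← hc]⟩

/-- Test functions are real-valued and `f` is only real-linear, so its real and imaginary parts are
treated separately. -/
theorem exists_isPolynomial {m : ℕ} {f : Distr} (hf : ∀ φ, f (derivTest^[m] φ) = 0) :
    ∃ p : Polynomial ℂ, p.degree < (m : WithBot ℕ) ∧ IsPolynomial f p := by
  obtain ⟨a, ha⟩ := exists_eq_sum_moment (L := Complex.reLm ∘ₗ toLinearMap f) fun φ =>
    (congrArg Complex.re (hf φ) : _)
  obtain ⟨b, hb⟩ := exists_eq_sum_moment (L := Complex.imLm ∘ₗ toLinearMap f) fun φ =>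
    (congrArg Complex.im (hf φ) : _)
  refine ⟨∑ k : Fin m, Polynomial.C (a k + b k * Complex.I) * Polynomial.X ^ (k : ℕ),
    Polynomial.degree_sum_fin_lt _, fun φ => ?_⟩
  have hfφ : f φ = ∑ k : Fin m, (a k + b k * Complex.I) * (moment k φ : ℂ) := by
    rw [← Complex.re_add_im (f φ), show (f φ).re = _ from ha φ, show (f φ).im = _ from hb φ]
    push_cast
    rw [Finset.sum_mul, ← Finset.sum_add_distrib]
    exact Finset.sum_congr rfl fun k _ => by ring
  have hint : ∀ k : Fin m, Integrable fun t : ℝ =>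
      (a k + b k * Complex.I) * ((t ^ (k : ℕ) * φ t : ℝ) : ℂ) := fun k =>
    (integrable_mul_test (by fun_prop) φ).ofReal.const_mul _
  rw [hfφ]
  simp_rw [moment_apply, ← integral_complex_ofReal, ← integral_const_mul]
  rw [← integral_finsetSum _ fun k _ => hint k]
  refine integral_congr_ae (.of_forall fun t => ?_)
  simp only [Polynomial.eval_finsetSum, Polynomial.eval_mul, Polynomial.eval_C,
    Polynomial.eval_pow, Polynomial.eval_X, Finset.mul_sum]
  exact Finset.sum_congr rfl fun k _ => by push_cast; ring

end Moments

end MontelDistribution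

end

theorem corollary2p5 (m : ℕ) (f : MontelDistribution.Distr) (h₁ h₂ : ℝ)
    (hh₁ : h₁ ≠ 0) (hh₂ : h₂ ≠ 0) (hirr : Irrational (h₁ / h₂))
    (hf₁ : (MontelDistribution.difference h₁ ^ m) f = 0)
    (hf₂ : (MontelDistribution.difference h₂ ^ m) f = 0) :
    ∃ p : Polynomial ℂ, p.degree < (m : WithBot ℕ) ∧
      MontelDistribution.IsPolynomial f p :=
  MontelDistribution.exists_isPolynomial
    (MontelDistribution.apply_derivTest_iterate_eq_zero hh₁ hirr hf₁ hf₂)
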